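/- Let $n\ge 1$ and let $\mathfrak S_n$ be the set of permutations $\sigma=\sigma(1)\cdots\sigma(n)$ of $\{1,\dots,n\}$. With the boundary convention $\sigma(0)=\sigma(n+1)=0$, an entry $\sigma(i)$ ($1\le i\le n$) is a *valley* if $\sigma(i-1)>\sigma(i)<\sigma(i+1)$, a *double ascent* if $\sigma(i-1)<\sigma(i)<\sigma(i+1)$, and a *double descent* if $\sigma(i-1)>\sigma(i)>\sigma(i+1)$; let $\mathrm{valley}^*\sigma$, $\mathrm{da}^*\sigma$, $\mathrm{dd}^*\sigma$ be the numbers of these. Let $\mathrm{des}\,\sigma$ be the number of $i$ with $1\le i<n$ and $\sigma(i)>\sigma(i+1)$, let $\mathrm{les}\,\sigma$ be the number of pairs $2\le i<j\le n$ with $\sigma(i-1)>\sigma(j)>\sigma(i)$, and let $\mathrm{res}\,\sigma$ be the number of pairs $1\le i<j\le n-1$ with $\sigma(j+1)>\sigma(i)>\sigma(j)$. Put $$A_n(p,q,t,u,v,w)=\sum_{\sigma\in\mathfrak S_n}p^{\mathrm{res}\,\sigma}q^{\mathrm{les}\,\sigma}t^{\mathrm{des}\,\sigma}u^{\mathrm{da}^*\sigma}v^{\mathrm{dd}^*\sigma}w^{\mathrm{valley}^*\sigma}\in\mathbb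 Z[p,q,t,u,v,w],$$ $$a_{n,k}(p,q)=\sum_{\sigma}p^{\mathrm{res}\,\sigma}q^{\mathrm{les}\,\sigma}\in\mathbb Z[p,q],$$ the last sum running over all $\sigma\in\mathfrak S_n$ with $\mathrm{valley}^*\sigma=k$ and $\mathrm{dd}^*\sigma=0$. Then $$A_n(p,q,t,u,v,w)=\sum_{k=0}^{\lfloor (n-1)/2\rfloor}a_{n,k}(p,q)\,(tw)^k\,(u+vt)^{n-1-2k},$$ and $(p+q)^k$ divides $a_{n,k}(p,q)$ in $\mathbb Z[p,q]$ for all $0\le k\le\lfloor (n-1)/2\rfloor$. Moreover, for all $0\le k\le\lfloor (n-1)/2\rfloor$, $$2^{n-1-2k}\,a_{n,k}(p,q)=\sum_{\sigma}p^{(13\text{-}2)\sigma}q^{(2\text{-}31)\sigma},$$ where the sum runs over the $\sigma\in\mathfrak S_n$ with exactly $k$ peaks ($\sigma(i-1)<\sigma(i)>\sigma(i+1)$, $1\le i\le n$) for the convention $\sigma(0)=\sigma(n+1)=n+1$, $(13\text{-}2)\sigma$ is the number of pairs $2\le i<j\le n$ with $\sigma(i-1)<\sigma(j)<\sigma(i)$,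 and $(2\text{-}31)\sigma$ is the number of pairs $1\le i<j\le n-1$ with $\sigma(j+1)<\sigma(i)<\sigma(j)$. Hence the divisibility above is Brändén's conjecture that $(p+q)^k$ divides $2^{-n+1+2k}\sum_{\sigma}p^{(13\text{-}2)\sigma}q^{(2\text{-}31)\sigma}$. -/

import Mathlib

/-!
Permutations of `[n] = {1, …, n}` are represented by `Equiv.Perm (Fin n)`; the one-line notation
`σ(1) … σ(n)` with 1-based positions and values, together with the boundary values `σ(0)` and
`σ(n+1)`, is given by `PermStat.word`.
-/

namespace PermStat

open MvPolynomial

/-- The one-line notation of `σ` with boundary value `b`: for `1 ≤ i ≤ n` it is the (1-based)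
value `σ(i) ∈ {1, …, n}`, and it is `b` at every other position, in particular at `0`, `n + 1`. -/
def word {n : ℕ} (b : ℕ) (σ : Equiv.Perm (Fin n)) (i : ℕ) : ℕ :=
  if h : 1 ≤ i ∧ i ≤ n then (σ ⟨i - 1, by omega⟩ : ℕ) + 1 else b

/-- The number of descents: `1 ≤ i < n` with `σ(i) > σ(i+1)`. -/
def des {n : ℕ} (σ : Equiv.Perm (Fin n)) : ℕ :=
  ((Finset.Icc 1 n).filter fun i => i < n ∧ word 0 σ i > word 0 σ (i + 1)).card

/-- The number of peaks, for the convention `σ(0) = σ(n+1) = b`. -/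
def peak {n : ℕ} (b : ℕ) (σ : Equiv.Perm (Fin n)) : ℕ :=
  ((Finset.Icc 1 n).filter fun i =>
    word b σ (i - 1) < word b σ i ∧ word b σ i > word b σ (i + 1)).card

/-- The number of valleys, for the convention `σ(0) = σ(n+1) = b`. -/
def valley {n : ℕ} (b : ℕ) (σ : Equiv.Perm (Fin n)) : ℕ :=
  ((Finset.Icc 1 n).filter fun i =>
    word b σ (i - 1) > word b σ i ∧ word b σ i < word b σ (i + 1)).card

/-- The number of double ascents, for the convention `σ(0) = σ(n+1) = b`. -/
def doubleAscent {n : ℕ} (b : ℕ) (σ : Equiv.Perm (Fin n)) : ℕ :=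
  ((Finset.Icc 1 n).filter fun i =>
    word b σ (i - 1) < word b σ i ∧ word b σ i < word b σ (i + 1)).card

/-- The number of double descents, for the convention `σ(0) = σ(n+1) = b`. -/
def doubleDescent {n : ℕ} (b : ℕ) (σ : Equiv.Perm (Fin n)) : ℕ :=
  ((Finset.Icc 1 n).filter fun i =>
    word b σ (i - 1) > word b σ i ∧ word b σ i > word b σ (i + 1)).card

/-- The number of pairs `2 ≤ i < j ≤ n` with `σ(i-1) > σ(j) > σ(i)` (pattern 31-2). -/
def les {n : ℕ} (σ : Equiv.Perm (Fin n)) : ℕ :=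
  ((Finset.Icc 1 n ×ˢ Finset.Icc 1 n).filter fun x =>
    2 ≤ x.1 ∧ x.1 < x.2 ∧ x.2 ≤ n ∧
      word 0 σ (x.1 - 1) > word 0 σ x.2 ∧ word 0 σ x.2 > word 0 σ x.1).card

/-- The number of pairs `1 ≤ i < j ≤ n - 1` with `σ(j+1) > σ(i) > σ(j)` (pattern 2-13). -/
def res {n : ℕ} (σ : Equiv.Perm (Fin n)) : ℕ :=
  ((Finset.Icc 1 n ×ˢ Finset.Icc 1 n).filter fun x =>
    1 ≤ x.1 ∧ x.1 < x.2 ∧ x.2 + 1 ≤ n ∧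
      word 0 σ (x.2 + 1) > word 0 σ x.1 ∧ word 0 σ x.1 > word 0 σ x.2).card

/-- The number of pairs `2 ≤ i < j ≤ n` with `σ(i-1) < σ(j) < σ(i)` (pattern 13-2). -/
def pat13_2 {n : ℕ} (σ : Equiv.Perm (Fin n)) : ℕ :=
  ((Finset.Icc 1 n ×ˢ Finset.Icc 1 n).filter fun x =>
    2 ≤ x.1 ∧ x.1 < x.2 ∧ x.2 ≤ n ∧
      word 0 σ (x.1 - 1) < word 0 σ x.2 ∧ word 0 σ x.2 < word 0 σ x.1).card

/-- The number of pairs `1 ≤ i < j ≤ n - 1` with `σ(j+1) < σ(i) < σ(j)` (pattern 2-31). -/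
def pat2_31 {n : ℕ} (σ : Equiv.Perm (Fin n)) : ℕ :=
  ((Finset.Icc 1 n ×ˢ Finset.Icc 1 n).filter fun x =>
    1 ≤ x.1 ∧ x.1 < x.2 ∧ x.2 + 1 ≤ n ∧
      word 0 σ (x.2 + 1) < word 0 σ x.1 ∧ word 0 σ x.1 < word 0 σ x.2).card

/-- The generalized Eulerian polynomial `A_n(p,q,t,u,v,w)` in `ℤ[p,q,t,u,v,w]`; the variables
`p, q, t, u, v, w` are `X 0, …, X 5` in this order. The boundary convention is
`σ(0) = σ(n+1) = 0`. -/
noncomputable def genEulerian (n : ℕ) : MvPolynomial (Fin 6) ℤ :=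
  ∑ σ : Equiv.Perm (Fin n),
    X 0 ^ res σ * X 1 ^ les σ * X 2 ^ des σ *
      X 3 ^ doubleAscent 0 σ * X 4 ^ doubleDescent 0 σ * X 5 ^ valley 0 σ

/-- The set of permutations with exactly `k` valleys and without double descents, for the
convention `σ(0) = σ(n+1) = 0`. -/
def permsValley (n k : ℕ) : Finset (Equiv.Perm (Fin n)) :=
  Finset.univ.filter fun σ => valley 0 σ = k ∧ doubleDescent 0 σ = 0

/-- The polynomial `a_{n,k}(p,q)` in `ℤ[p,q]`, with `p = X 0` and `q = X 1`. -/
noncomputable def gammaCoeff (n k : ℕ) : MvPolynomial (Fin 2) ℤ :=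
  ∑ σ ∈ permsValley n k, X 0 ^ res σ * X 1 ^ les σ

/-- The generating polynomial in `ℤ[p,q]` of the patterns 13-2 and 2-31 over the permutations with
exactly `k` peaks, for the convention `σ(0) = σ(n+1) = n + 1`. -/
noncomputable def peakSum (n k : ℕ) : MvPolynomial (Fin 2) ℤ :=
  ∑ σ ∈ (Finset.univ : Finset (Equiv.Perm (Fin n))).filter (fun σ => peak (n + 1) σ = k),
    X 0 ^ pat13_2 σ * X 1 ^ pat2_31 σ

/-- The inclusion `ℤ[p,q] ⊆ ℤ[p,q,t,u,v,w]`. -/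
noncomputable def inclPQ : MvPolynomial (Fin 2) ℤ →ₐ[ℤ] MvPolynomial (Fin 6) ℤ :=
  rename (Fin.castLE (by decide))

end PermStat

/-! The permutations are built by their smallest letter. Allow bars in the gaps of a permutation,
each bar acting as a letter below all others, with both ends barred; ordinary permutations with σ(0)
= σ(n+1) = 0 are the case of exactly two bars. Turning the smallest letter, together with any bars
adjacent to it, into a single bar changes no comparison seen by the remaining letters, so all their
statistics survive. The removed letter itself contributes q to the number of bars on its left minus
one, times p to the number on its right minus one. Summed over its possible places, N bars give
[N-1] = ∑ q^a p^(N-2-a).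

The number of bars grows by one if the letter is a valley, is unchanged for a double ascent or
descent, and drops by one for a peak. Hence (`barredSum_succ`, `barredSum_eq_motzkinSum`) the
generating function is a sum over Motzkin paths from height 2 to height 1, in which double ascents
(y) and double descents (z) enter only through the level weight y + z. Sorting paths by the number k
of up steps gives the expansion (`sum_perm_eq`).

All three claims are specializations. Taking y = 1, z = 0 identifies a_{n,k} with the path
coefficient `motzkinCoeff`; y = z = 1 gives the power of 2, the peak sum following by
complementation and the symmetry in p and q. For divisibility, an up step leaving height h is
matched with a down step leaving h + 1, with weights [h-1] and [h]; one index is even, and p + q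
divides [r] for even r. -/

namespace PermStat

open Finset

/-! ### Weighted Motzkin paths -/

section Motzkin

variable {R S : Type*} [CommRing R] [CommRing S]

/-- The `(p,q)`-analogue `∑_{a < k} q^a p^(k-1-a)` of the natural number `k`. -/
def pqNat (p q : R) (k : ℕ) : R := ∑ a ∈ range k, q ^ a * p ^ (k - 1 - a)

/-- The weighted sum over Motzkin paths of length `m` from height `N` to height `1`, in which a
step starting at height `N` has weight `[N-1]` times `x` (up), `y` (level) or `z` (down). -/
def motzkinSum (p q x y z : R) : ℕ → ℕ → R
  | 0, N => if N = 1 then 1 else 0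
  | m + 1, N => pqNat p q (N - 1) * (x * motzkinSum p q x y z m (N + 1) +
      y * motzkinSum p q x y z m N + z * motzkinSum p q x y z m (N - 1))

/-- The part of `motzkinSum` coming from the paths with exactly `k` up steps. -/
def motzkinCoeff (p q : R) : ℕ → ℕ → ℕ → R
  | 0, N, k => if N = 1 ∧ k = 0 then 1 else 0
  | m + 1, N, k => pqNat p q (N - 1) * ((if k = 0 then 0 else motzkinCoeff p q m (N + 1) (k - 1)) +
      motzkinCoeff p q m N k + motzkinCoeff p q m (N - 1) k)

theorem pqNat_zero (p q : R) : pqNat p q 0 = 0 := by simp [pqNat]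

theorem pqNat_comm (p q : R) (k : ℕ) : pqNat p q k = pqNat q p k := by
  unfold pqNat
  rw [← sum_range_reflect]
  refine sum_congr rfl fun a ha => ?_
  rw [mem_range] at ha
  rw [mul_comm, show k - 1 - (k - 1 - a) = a by omega]

theorem map_pqNat (f : R →+* S) (p q : R) (k : ℕ) : f (pqNat p q k) = pqNat (f p) (f q) k := by
  simp [pqNat]

/-- Steps of two keep the parity: for even k the split-off powers have odd exponent, so p + q
divides their sum. -/
theorem pqNat_succ_succ (p q : R) (k : ℕ) :
    pqNat p q (k + 2) = q ^ (k + 1) + p ^ (k + 1) + p * q * pqNat p q k := by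
  unfold pqNat
  rw [sum_range_succ, sum_range_succ', mul_sum]
  have : ∀ a ∈ range k, q ^ (a + 1) * p ^ (k + 2 - 1 - (a + 1)) =
      p * q * (q ^ a * p ^ (k - 1 - a)) := by
    intro a ha
    rw [mem_range] at ha
    rw [show k + 2 - 1 - (a + 1) = (k - 1 - a) + 1 by omega]
    ring
  rw [sum_congr rfl this]
  simp
  ring

theorem add_dvd_pqNat_of_even (p q : R) {k : ℕ} (hk : Even k) : p + q ∣ pqNat p q k := by
  obtain ⟨r, rfl⟩ := hk
  induction r with
  | zero => simp [pqNat_zero]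
  | succ r ih =>
    rw [show r + 1 + (r + 1) = (r + r) + 2 by omega, pqNat_succ_succ]
    refine dvd_add ?_ (ih.mul_left _)
    rw [add_comm (q ^ _)]
    exact Odd.add_dvd_pow_add_pow p q (by simp)

theorem motzkinCoeff_comm (p q : R) (m N k : ℕ) :
    motzkinCoeff p q m N k = motzkinCoeff q p m N k := by
  induction m generalizing N k with
  | zero => rfl
  | succ m ih => simp only [motzkinCoeff, ih, pqNat_comm p q]

theorem map_motzkinCoeff (f : R →+* S) (p q : R) (m N k : ℕ) :
    f (motzkinCoeff p q m N k) = motzkinCoeff (f p) (f q) m N k := by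
  induction m generalizing N k with
  | zero => simp [motzkinCoeff, apply_ite f]
  | succ m ih => simp [motzkinCoeff, apply_ite f, ih, map_pqNat]

/-- Paths with `k` up steps from height `N` to height `1` have at least `2 * k + N - 1` steps. -/
theorem motzkinCoeff_eq_zero (p q : R) {m N k : ℕ} (h : m + 1 < N + 2 * k) :
    motzkinCoeff p q m N k = 0 := by
  induction m generalizing N k with
  | zero => simp only [motzkinCoeff]; rw [if_neg]; omega
  | succ m ih =>
    rw [motzkinCoeff, ih (show m + 1 < N + 2 * k by omega)]
    rw [ih (N := N - 1) (by omega)]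
    split_ifs with hk
    · simp
    · rw [ih (by omega)]; simp

/-- Each up step is paired with a down step, and one of the two weights is divisible by `p + q`;
so is every second weight of the remaining down steps. -/
theorem add_pow_dvd_motzkinCoeff (p q : R) (m N k : ℕ) :
    (p + q) ^ (k + (N - 1) / 2) ∣ motzkinCoeff p q m N k := by
  induction m generalizing N k with
  | zero =>
    simp only [motzkinCoeff]
    split_ifs with h
    · simp [h.1, h.2]
    · exact dvd_zero _
  | succ m ih =>
    rw [motzkinCoeff, mul_add, mul_add]
    -- The weight of the current step supplies one factor p + q exactly when N - 1 is even.
    have key : ∀ {e : ℕ} {c : R}, (p + q) ^ e ∣ c →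
        (k + (N - 1) / 2 ≤ e ∨ (k + (N - 1) / 2 ≤ e + 1 ∧ Even (N - 1))) →
        (p + q) ^ (k + (N - 1) / 2) ∣ pqNat p q (N - 1) * c := by
      rintro e c hc (h | ⟨h, hN⟩)
      · exact ((pow_dvd_pow _ h).trans hc).mul_left _
      · refine (pow_dvd_pow _ h).trans ?_
        rw [pow_succ']
        exact mul_dvd_mul (add_dvd_pqNat_of_even p q hN) hc
    refine dvd_add (dvd_add ?_ (key (ih N k) (Or.inl le_rfl))) (key (ih (N - 1) k) ?_)
    · split_ifs with hk
      · simp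
      · refine key (ih (N + 1) (k - 1)) ?_
        rw [Nat.even_iff]; omega
    · rw [Nat.even_iff]; omega

/-- A path with k up steps has k + N - 1 down steps, hence m + 1 - N - 2k level ones. The bound `hK`
makes the range contain every k that occurs. -/
theorem motzkinSum_eq_sum (p q x y : R) {m N K : ℕ} (hK : m ≤ N + 2 * K) (hN : 1 ≤ N) :
    motzkinSum p q x y 1 m N =
      ∑ k ∈ range (K + 1), motzkinCoeff p q m N k * x ^ k * y ^ (m + 1 - N - 2 * k) := by
  induction m generalizing N K with
  | zero =>
    simp only [motzkinSum, motzkinCoeff]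
    rw [sum_range_succ']
    by_cases h : N = 1 <;> simp [h]
  | succ m ih =>
    -- No path leaves height 1, where the weight is [0] = 0; above it, N - 1 ≥ 1 and induction
    -- applies.
    obtain rfl | hN2 := hN.eq_or_lt
    · simp [motzkinSum, motzkinCoeff, pqNat_zero]
    have h1 : x * motzkinSum p q x y 1 m (N + 1) = ∑ k ∈ range (K + 1),
        (if k = 0 then 0 else motzkinCoeff p q m (N + 1) (k - 1)) * x ^ k *
          y ^ (m + 1 + 1 - N - 2 * k) := by
      rw [sum_range_succ']
      obtain _ | K := K
      · rw [ih (K := 0) (by omega) (by omega)]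
        simp [motzkinCoeff_eq_zero p q (show m + 1 < N + 1 + 2 * 0 by omega)]
      · rw [ih (K := K) (by omega) (by omega), mul_sum]
        simp
        refine sum_congr rfl fun k _ => ?_
        rw [show m + 1 + 1 - N - 2 * (k + 1) = m - N - 2 * k by omega]
        ring
    have h2 : y * motzkinSum p q x y 1 m N = ∑ k ∈ range (K + 1),
        motzkinCoeff p q m N k * x ^ k * y ^ (m + 1 + 1 - N - 2 * k) := by
      rw [ih (K := K) (by omega) hN, mul_sum]
      refine sum_congr rfl fun k _ => ?_
      -- The exponent subtraction truncates only where the coefficient vanishes.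
      by_cases h : m + 1 < N + 2 * k
      · simp [motzkinCoeff_eq_zero p q h]
      · rw [show m + 1 + 1 - N - 2 * k = m + 1 - N - 2 * k + 1 by omega]
        ring
    have h3 : 1 * motzkinSum p q x y 1 m (N - 1) = ∑ k ∈ range (K + 1),
        motzkinCoeff p q m (N - 1) k * x ^ k * y ^ (m + 1 + 1 - N - 2 * k) := by
      rw [one_mul, ih (K := K) (by omega) (by omega)]
      refine sum_congr rfl fun k _ => ?_
      rw [show m + 1 - (N - 1) - 2 * k = m + 1 + 1 - N - 2 * k by omega]
    rw [motzkinSum, h1, h2, h3, ← sum_add_distrib, ← sum_add_distrib, mul_sum]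
    refine sum_congr rfl fun k _ => ?_
    rw [motzkinCoeff]
    ring

end Motzkin

/-- Summing over the elements of a finite set a function of the numbers of smaller and of larger
elements. -/
theorem sum_card_lt_card_gt {α M : Type*} [LinearOrder α] [AddCommMonoid M] (s : Finset α)
    (f : ℕ → ℕ → M) :
    ∑ j ∈ s, f #{g ∈ s | g < j} #{g ∈ s | j < g} = ∑ a ∈ range #s, f a (#s - 1 - a) := by
  induction s using Finset.induction_on_max generalizing f with
  | empty => simp
  | insert M s hM ih =>
    have hMs : M ∉ s := fun h => lt_irrefl _ (hM M h)
    rw [sum_insert hMs, card_insert_of_notMem hMs, sum_range_succ, add_comm]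
    congr 1
    -- The new maximum adds one larger element to the count of every old element.
    · have := ih fun a b => f a (b + 1)
      rw [sum_congr rfl (g := fun a => f a (#s - 1 - a + 1))] at this
      · rw [sum_congr rfl (g := fun a => f a (#s - 1 - a + 1)), ← this]
        · refine sum_congr rfl fun j hj => ?_
          rw [filter_insert, filter_insert, if_neg (hM j hj).not_gt, if_pos (hM j hj),
            card_insert_of_notMem (by simp [hMs])]
        · intro a ha
          rw [mem_range] at ha
          congr 1; omega
      · intros; rfl
    · rw [filter_insert, filter_insert, if_neg (lt_irrefl _), if_neg (lt_irrefl _),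
        filter_true_of_mem hM, filter_false_of_mem fun x hx => (hM x hx).not_gt]
      simp

/-! ### Barred permutations

A barred permutation is a permutation `σ` of `Fin m` together with a choice `β` of bars in the
`m + 1` gaps before, between and after its letters; a bar acts as a letter that is smaller than all
the others. -/

section Barred

variable {m : ℕ}

/-- The letter or bar directly to the left of position `k` is smaller than `c`. -/
def LeftBelow (σ : Equiv.Perm (Fin m)) (β : Fin (m + 1) → Bool) (c k : Fin m) : Prop :=
  β k.castSucc = true ∨ ∃ l : Fin m, (l : ℕ) + 1 = k ∧ σ l < c

/-- The letter or bar directly to the right of position `k` is smaller than `c`. -/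
def RightBelow (σ : Equiv.Perm (Fin m)) (β : Fin (m + 1) → Bool) (c k : Fin m) : Prop :=
  β k.succ = true ∨ ∃ l : Fin m, (l : ℕ) = k + 1 ∧ σ l < c

instance (σ : Equiv.Perm (Fin m)) (β : Fin (m + 1) → Bool) (c k : Fin m) :
    Decidable (LeftBelow σ β c k) := by unfold LeftBelow; infer_instance

instance (σ : Equiv.Perm (Fin m)) (β : Fin (m + 1) → Bool) (c k : Fin m) :
    Decidable (RightBelow σ β c k) := by unfold RightBelow; infer_instance

/-- The number of descents to the left of position `i` across the value `σ i`. -/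
def leftCross (σ : Equiv.Perm (Fin m)) (β : Fin (m + 1) → Bool) (i : Fin m) : ℕ :=
  #{k : Fin m | k < i ∧ σ i < σ k ∧ RightBelow σ β (σ i) k}

/-- The number of ascents to the right of position `i` across the value `σ i`. -/
def rightCross (σ : Equiv.Perm (Fin m)) (β : Fin (m + 1) → Bool) (i : Fin m) : ℕ :=
  #{k : Fin m | i < k ∧ σ i < σ k ∧ LeftBelow σ β (σ i) k}

/-- Insert a new smallest letter at position `j`. -/
def insertMin (j : Fin (m + 1)) (τ : Equiv.Perm (Fin m)) : Equiv.Perm (Fin (m + 1)) :=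
  ((finSuccEquiv' j).trans (Equiv.optionCongr τ)).trans (finSuccEquiv' 0).symm

@[simp]
theorem insertMin_self (j : Fin (m + 1)) (τ : Equiv.Perm (Fin m)) : insertMin j τ j = 0 := by
  simp [insertMin]

@[simp]
theorem insertMin_succAbove (j : Fin (m + 1)) (τ : Equiv.Perm (Fin m)) (i : Fin m) :
    insertMin j τ (j.succAbove i) = (τ i).succ := by
  simp [insertMin]

theorem insertMin_bijective :
    Function.Bijective fun x : Fin (m + 1) × Equiv.Perm (Fin m) => insertMin x.1 x.2 := by
  rw [Fintype.bijective_iff_injective_and_card]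
  constructor
  · rintro ⟨j, τ⟩ ⟨j', τ'⟩ h
    dsimp only at h
    have hj : j = j' := by
      apply (insertMin j' τ').injective
      rw [insertMin_self, ← h, insertMin_self]
    subst hj
    congr 1
    ext i : 1
    have := congrArg (fun e : Equiv.Perm (Fin (m + 1)) => e (j.succAbove i)) h
    simpa using this
  · simp [Fintype.card_perm, Nat.factorial_succ]

theorem sum_perm_succ {M : Type*} [AddCommMonoid M] (f : Equiv.Perm (Fin (m + 1)) → M) :
    ∑ σ, f σ = ∑ j, ∑ τ, f (insertMin j τ) := by
  rw [← insertMin_bijective.sum_comp, Fintype.sum_prod_type]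

/-- Split the gap `j` into two gaps, with bars as prescribed by `a` and `b`. -/
def splitGap (j : Fin (m + 1)) (a b : Bool) (β : Fin (m + 1) → Bool) : Fin (m + 2) → Bool :=
  Fin.insertNth (α := fun _ => Bool) j.castSucc a (Function.update β j b)

@[simp]
theorem splitGap_castSucc (j : Fin (m + 1)) (a b : Bool) (β : Fin (m + 1) → Bool) :
    splitGap j a b β j.castSucc = a := by
  simp [splitGap]

@[simp]
theorem splitGap_succ (j : Fin (m + 1)) (a b : Bool) (β : Fin (m + 1) → Bool) :
    splitGap j a b β j.succ = b := by
  have : j.succ = j.castSucc.succAbove j := by simp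
  rw [splitGap, this, Fin.insertNth_apply_succAbove]
  simp

theorem splitGap_castSucc_succAbove (j : Fin (m + 1)) (a b : Bool) (β : Fin (m + 1) → Bool)
    (g : Fin (m + 1)) :
    splitGap j a b β (j.castSucc.succAbove g) = Function.update β j b g := by
  simp [splitGap]

theorem splitGap_of_lt (j : Fin (m + 1)) (a b : Bool) (β : Fin (m + 1) → Bool)
    (g : Fin (m + 1)) (h : g < j) : splitGap j a b β g.castSucc = β g := by
  have := splitGap_castSucc_succAbove j a b β g
  rwa [Fin.succAbove_of_castSucc_lt _ _ (by simpa using h),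
    Function.update_of_ne h.ne] at this

theorem splitGap_of_gt (j : Fin (m + 1)) (a b : Bool) (β : Fin (m + 1) → Bool)
    (g : Fin (m + 1)) (h : j < g) : splitGap j a b β g.succ = β g := by
  have := splitGap_castSucc_succAbove j a b β g
  rwa [Fin.succAbove_of_le_castSucc _ _ (by simpa using h.le),
    Function.update_of_ne h.ne'] at this

theorem sum_bars_succ {M : Type*} [AddCommMonoid M] (j : Fin (m + 1))
    (f : (Fin (m + 2) → Bool) → M) :
    ∑ β, f β = ∑ β : Fin (m + 1) → Bool with β j = true, ∑ a, ∑ b, f (splitGap j a b β) := by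
  simp_rw [← Fintype.sum_prod_type']
  rw [← sum_product']
  symm
  refine sum_nbij' (fun x => splitGap j x.2.1 x.2.2 x.1)
    -- Merging the two gaps always leaves a bar; fixing `β j = true` makes the decomposition unique.
    (fun β => (Function.update (fun g => β (j.castSucc.succAbove g)) j true,
      β j.castSucc, β j.succ)) ?_ ?_ ?_ ?_ ?_
  · simp
  · simp
  · rintro ⟨β, a, b⟩ h
    simp only [mem_product, mem_filter, mem_univ, true_and, and_true] at h
    simp only [splitGap_castSucc, splitGap_succ, splitGap_castSucc_succAbove, Prod.mk.injEq,
      and_true]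
    ext g : 1
    by_cases hg : g = j
    · subst hg; simp [h]
    · simp [hg]
  · intro β _
    ext g : 1
    dsimp only
    induction g using Fin.succAboveCases j.castSucc with
    | x => simp
    | p g =>
      rw [splitGap_castSucc_succAbove]
      by_cases hg : g = j
      · subst hg; simp
      · simp [hg]
  · simp

/-! ### Effect of inserting a smallest letter on the statistics -/

theorem rightBelow_insertMin (j : Fin (m + 1)) (a b : Bool) (τ : Equiv.Perm (Fin m))
    (β : Fin (m + 1) → Bool) (hβ : β j = true) (c k : Fin m) :
    RightBelow (insertMin j τ) (splitGap j a b β) c.succ (j.succAbove k) ↔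
      RightBelow τ β c k := by
  unfold RightBelow
  rcases lt_trichotomy k.succ j with h | h | h
  · have h1 : j.succAbove k = k.castSucc :=
      Fin.succAbove_of_castSucc_lt _ _ (lt_trans (Fin.castSucc_lt_succ) h)
    rw [h1, Fin.succ_castSucc, splitGap_of_lt _ _ _ _ _ h]
    refine or_congr Iff.rfl ⟨?_, ?_⟩
    · rintro ⟨l, hl, hl'⟩
      induction l using Fin.succAboveCases j with
      | x => simp [Fin.lt_def] at h hl; omega
      | p l =>
        refine ⟨l, ?_, by simpa using hl'⟩
        simp [Fin.succAbove, Fin.lt_def] at h hl ⊢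
        split_ifs at hl <;> simp at hl <;> omega
    · rintro ⟨l, hl, hl'⟩
      refine ⟨j.succAbove l, ?_, by simpa using hl'⟩
      rw [Fin.succAbove_of_castSucc_lt]
      · simpa using hl
      · simp [Fin.lt_def] at h ⊢; omega
  -- Here the right neighbour is the new smallest letter on one side and the bar at `j` on the
  -- other, so both sides hold.
  · have h1 : j.succAbove k = k.castSucc :=
      Fin.succAbove_of_castSucc_lt _ _ (h ▸ Fin.castSucc_lt_succ)
    rw [h]
    simp only [hβ, true_or, iff_true]
    refine Or.inr ⟨j, ?_, by simp⟩
    rw [h1, ← h]; simp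
  · have h1 : j.succAbove k = k.succ :=
      Fin.succAbove_of_le_castSucc _ _ (by simp [Fin.lt_def, Fin.le_def] at h ⊢; omega)
    rw [h1, splitGap_of_gt _ _ _ _ _ h]
    refine or_congr Iff.rfl ⟨?_, ?_⟩
    · rintro ⟨l, hl, hl'⟩
      induction l using Fin.succAboveCases j with
      | x => simp [Fin.lt_def] at h hl; omega
      | p l =>
        refine ⟨l, ?_, by simpa using hl'⟩
        simp [Fin.succAbove, Fin.lt_def] at h hl ⊢
        split_ifs at hl <;> simp at hl <;> omega
    · rintro ⟨l, hl, hl'⟩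
      refine ⟨j.succAbove l, ?_, by simpa using hl'⟩
      rw [Fin.succAbove_of_le_castSucc]
      · simpa using hl
      · simp [Fin.lt_def, Fin.le_def] at h ⊢; omega

theorem leftBelow_insertMin (j : Fin (m + 1)) (a b : Bool) (τ : Equiv.Perm (Fin m))
    (β : Fin (m + 1) → Bool) (hβ : β j = true) (c k : Fin m) :
    LeftBelow (insertMin j τ) (splitGap j a b β) c.succ (j.succAbove k) ↔
      LeftBelow τ β c k := by
  unfold LeftBelow
  rcases lt_trichotomy k.castSucc j with h | h | h
  · have h1 : j.succAbove k = k.castSucc := Fin.succAbove_of_castSucc_lt _ _ h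
    rw [h1, splitGap_of_lt _ _ _ _ _ h]
    refine or_congr Iff.rfl ⟨?_, ?_⟩
    · rintro ⟨l, hl, hl'⟩
      induction l using Fin.succAboveCases j with
      | x => simp [Fin.lt_def] at h hl; omega
      | p l =>
        refine ⟨l, ?_, by simpa using hl'⟩
        simp [Fin.succAbove, Fin.lt_def] at h hl ⊢
        split_ifs at hl <;> simp at hl <;> omega
    · rintro ⟨l, hl, hl'⟩
      refine ⟨j.succAbove l, ?_, by simpa using hl'⟩
      rw [Fin.succAbove_of_castSucc_lt]
      · simpa using hl
      · simp [Fin.lt_def] at h ⊢; omega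
  · have h1 : j.succAbove k = k.succ := Fin.succAbove_of_le_castSucc _ _ h.ge
    rw [h]
    simp only [hβ, true_or, iff_true]
    refine Or.inr ⟨j, ?_, by simp⟩
    rw [h1, ← h]; simp
  · have h1 : j.succAbove k = k.succ := Fin.succAbove_of_le_castSucc _ _ h.le
    rw [h1, ← Fin.succ_castSucc, splitGap_of_gt _ _ _ _ _ h]
    refine or_congr Iff.rfl ⟨?_, ?_⟩
    · rintro ⟨l, hl, hl'⟩
      induction l using Fin.succAboveCases j with
      | x => simp [Fin.lt_def] at h hl; omega
      | p l =>
        refine ⟨l, ?_, by simpa using hl'⟩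
        simp [Fin.succAbove, Fin.lt_def] at h hl ⊢
        split_ifs at hl <;> simp at hl <;> omega
    · rintro ⟨l, hl, hl'⟩
      refine ⟨j.succAbove l, ?_, by simpa using hl'⟩
      rw [Fin.succAbove_of_le_castSucc]
      · simpa using hl
      · simp [Fin.lt_def, Fin.le_def] at h ⊢; omega

/-- The new letter is too small to be the upper end of a crossing, and as a lower end it does what
the bar did. -/
theorem leftCross_insertMin (j : Fin (m + 1)) (a b : Bool) (τ : Equiv.Perm (Fin m))
    (β : Fin (m + 1) → Bool) (hβ : β j = true) (i : Fin m) :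
    leftCross (insertMin j τ) (splitGap j a b β) (j.succAbove i) = leftCross τ β i := by
  unfold leftCross
  rw [card_filter, card_filter, Fin.sum_univ_succAbove _ j]
  simp [rightBelow_insertMin j a b τ β hβ, Fin.succAbove_lt_succAbove_iff]

theorem rightCross_insertMin (j : Fin (m + 1)) (a b : Bool) (τ : Equiv.Perm (Fin m))
    (β : Fin (m + 1) → Bool) (hβ : β j = true) (i : Fin m) :
    rightCross (insertMin j τ) (splitGap j a b β) (j.succAbove i) = rightCross τ β i := by
  unfold rightCross
  rw [card_filter, card_filter, Fin.sum_univ_succAbove _ j]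
  simp [leftBelow_insertMin j a b τ β hβ, Fin.succAbove_lt_succAbove_iff]

theorem leftBelow_insertMin_self (j : Fin (m + 1)) (a b : Bool) (τ : Equiv.Perm (Fin m))
    (β : Fin (m + 1) → Bool) (k : Fin (m + 1)) :
    LeftBelow (insertMin j τ) (splitGap j a b β) 0 k ↔ splitGap j a b β k.castSucc = true := by
  simp [LeftBelow]

theorem rightBelow_insertMin_self (j : Fin (m + 1)) (a b : Bool) (τ : Equiv.Perm (Fin m))
    (β : Fin (m + 1) → Bool) (k : Fin (m + 1)) :
    RightBelow (insertMin j τ) (splitGap j a b β) 0 k ↔ splitGap j a b β k.succ = true := by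
  simp [RightBelow]

theorem insertMin_pos_of_ne (j : Fin (m + 1)) (τ : Equiv.Perm (Fin m)) {k : Fin (m + 1)}
    (hk : k ≠ j) : 0 < insertMin j τ k := by
  rw [Fin.pos_iff_ne_zero, ← insertMin_self j τ]
  exact fun h => hk ((insertMin j τ).injective h)

theorem sum_splitGap {M : Type*} [AddCommMonoid M] (j : Fin (m + 1)) (a b : Bool)
    (β : Fin (m + 1) → Bool) (F : Fin (m + 2) → Bool → M) :
    ∑ g, F g (splitGap j a b β g) = F j.castSucc a + (F j.succ b +
      ∑ i, F (j.castSucc.succAbove (j.succAbove i)) (β (j.succAbove i))) := by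
  rw [Fin.sum_univ_succAbove _ j.castSucc, Fin.sum_univ_succAbove _ j]
  simp [splitGap_castSucc_succAbove, ← Fin.succAbove_castSucc_self]

theorem castSucc_succAbove_succAbove_le_iff (j : Fin (m + 1)) (i : Fin m) :
    j.castSucc.succAbove (j.succAbove i) ≤ j.castSucc ↔ j.succAbove i < j := by
  simp only [Fin.succAbove, Fin.le_def, Fin.lt_def]
  split_ifs <;> simp_all <;> omega

theorem succ_le_castSucc_succAbove_succAbove_iff (j : Fin (m + 1)) (i : Fin m) :
    j.succ ≤ j.castSucc.succAbove (j.succAbove i) ↔ j < j.succAbove i := by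
  simp only [Fin.succAbove, Fin.le_def, Fin.lt_def]
  split_ifs <;> simp_all

/-- Only a bar lies below the new minimum, so crossings are the bars to its left that follow a
letter: all but the one at the left end, whence the + 1. -/
theorem leftCross_insertMin_self (j : Fin (m + 1)) (a b : Bool) (τ : Equiv.Perm (Fin m))
    (β : Fin (m + 1) → Bool) (h0 : splitGap j a b β 0 = true) :
    leftCross (insertMin j τ) (splitGap j a b β) j + 1 = #{g | β g = true ∧ g < j} + a.toNat := by
  have h1 : leftCross (insertMin j τ) (splitGap j a b β) j + 1 =
      #{g : Fin (m + 2) | splitGap j a b β g = true ∧ g ≤ j.castSucc} := by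
    unfold leftCross
    rw [card_filter, card_filter (fun g => splitGap j a b β g = true ∧ g ≤ j.castSucc),
      Fin.sum_univ_succ (n := m + 1), add_comm, if_pos ⟨h0, Fin.zero_le _⟩]
    congr 1
    refine sum_congr rfl fun k _ => ?_
    congr 1
    rw [insertMin_self, rightBelow_insertMin_self, eq_iff_iff, Fin.succ_le_castSucc_iff]
    exact ⟨fun h => ⟨h.2.2, h.1⟩, fun h => ⟨h.2, insertMin_pos_of_ne _ _ h.2.ne, h.1⟩⟩
  rw [h1, card_filter, card_filter,
    sum_splitGap j a b β fun g c => if c = true ∧ g ≤ j.castSucc then 1 else 0,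
    Fin.sum_univ_succAbove _ j]
  simp only [castSucc_succAbove_succAbove_le_iff]
  cases a <;> simp [Nat.add_comm]

theorem rightCross_insertMin_self (j : Fin (m + 1)) (a b : Bool) (τ : Equiv.Perm (Fin m))
    (β : Fin (m + 1) → Bool) (h0 : splitGap j a b β (Fin.last _) = true) :
    rightCross (insertMin j τ) (splitGap j a b β) j + 1 = #{g | β g = true ∧ j < g} + b.toNat := by
  have h1 : rightCross (insertMin j τ) (splitGap j a b β) j + 1 =
      #{g : Fin (m + 2) | splitGap j a b β g = true ∧ j.succ ≤ g} := by
    unfold rightCross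
    rw [card_filter, card_filter (fun g => splitGap j a b β g = true ∧ j.succ ≤ g),
      Fin.sum_univ_castSucc (n := m + 1), if_pos ⟨h0, Fin.le_last _⟩]
    congr 1
    refine sum_congr rfl fun k _ => ?_
    congr 1
    rw [insertMin_self, leftBelow_insertMin_self, eq_iff_iff, Fin.succ_le_castSucc_iff]
    exact ⟨fun h => ⟨h.2.2, h.1⟩, fun h => ⟨h.2, insertMin_pos_of_ne _ _ h.2.ne', h.1⟩⟩
  rw [h1, card_filter, card_filter,
    sum_splitGap j a b β fun g c => if c = true ∧ j.succ ≤ g then 1 else 0,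
    Fin.sum_univ_succAbove _ j]
  simp only [succ_le_castSucc_succAbove_succAbove_iff]
  cases b <;> simp [Nat.add_comm]

theorem card_splitGap (j : Fin (m + 1)) (a b : Bool) (β : Fin (m + 1) → Bool)
    (hβ : β j = true) :
    #{g | splitGap j a b β g = true} + 1 = #{g | β g = true} + a.toNat + b.toNat := by
  rw [card_filter, card_filter, sum_splitGap j a b β fun _ c => if c = true then 1 else 0,
    Fin.sum_univ_succAbove _ j]
  cases a <;> cases b <;> simp [hβ] <;> omega

/-- Only for `j = 0` can the end bar be lost; otherwise bar 0 is itself counted on the left. Phrased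
by counts, the condition fits `sum_card_lt_card_gt`. -/
theorem splitGap_zero_iff (j : Fin (m + 1)) (a b : Bool) (β : Fin (m + 1) → Bool)
    (hβ : β j = true) :
    splitGap j a b β 0 = true ↔
      β 0 = true ∧ 1 ≤ #{g | β g = true ∧ g < j} + a.toNat := by
  by_cases hj : j = 0
  · subst hj
    have := splitGap_castSucc (0 : Fin (m + 1)) a b β
    rw [Fin.castSucc_zero] at this
    rw [this]
    cases a <;> simp [hβ]
  · have hj' : 0 < j := Fin.pos_iff_ne_zero.2 hj
    rw [← Fin.castSucc_zero, splitGap_of_lt _ _ _ _ _ hj']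
    refine ⟨fun h => ⟨h, ?_⟩, fun h => h.1⟩
    have : 0 < #{g | β g = true ∧ g < j} := card_pos.2 ⟨0, by simp [h, hj']⟩
    omega

theorem splitGap_last_iff (j : Fin (m + 1)) (a b : Bool) (β : Fin (m + 1) → Bool)
    (hβ : β j = true) :
    splitGap j a b β (Fin.last _) = true ↔
      β (Fin.last _) = true ∧ 1 ≤ #{g | β g = true ∧ j < g} + b.toNat := by
  by_cases hj : j = Fin.last m
  · subst hj
    have := splitGap_succ (Fin.last m) a b β
    rw [Fin.succ_last] at this
    rw [this]
    cases b <;> simp [hβ, Fin.le_last]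
  · have hj' : j < Fin.last m := Fin.lt_last_iff_ne_last.2 hj
    rw [← Fin.succ_last, splitGap_of_gt _ _ _ _ _ hj']
    refine ⟨fun h => ⟨h, ?_⟩, fun h => h.1⟩
    have : 0 < #{g | β g = true ∧ j < g} := card_pos.2 ⟨Fin.last m, by simp [h, hj']⟩
    omega

/-! ### The recursion for the generating function -/

variable {R : Type*} [CommRing R]

/-- The weight of a barred permutation; `T` is the weight of a letter, depending on whether its left
and its right neighbours are smaller. -/
def barredWeight (p q : R) (T : Bool → Bool → R) (σ : Equiv.Perm (Fin m))
    (β : Fin (m + 1) → Bool) : R :=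
  ∏ i, q ^ leftCross σ β i * p ^ rightCross σ β i *
    T (decide (LeftBelow σ β (σ i) i)) (decide (RightBelow σ β (σ i) i))

/-- The placements of `N` bars, one of them at each end. -/
def bars (m N : ℕ) : Finset (Fin (m + 1) → Bool) :=
  {β | β 0 = true ∧ β (Fin.last m) = true ∧ #{g | β g = true} = N}

/-- The generating function of the barred permutations of `Fin m` with `N` bars. -/
def barredSum (p q : R) (T : Bool → Bool → R) (m N : ℕ) : R :=
  ∑ σ : Equiv.Perm (Fin m), ∑ β ∈ bars m N, barredWeight p q T σ β

theorem barredWeight_insertMin (p q : R) (T : Bool → Bool → R) (j : Fin (m + 1)) (a b : Bool)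
    (τ : Equiv.Perm (Fin m)) (β : Fin (m + 1) → Bool) (hβ : β j = true)
    (h0 : splitGap j a b β 0 = true) (h1 : splitGap j a b β (Fin.last _) = true) :
    barredWeight p q T (insertMin j τ) (splitGap j a b β) =
      q ^ (#{g | β g = true ∧ g < j} + a.toNat - 1) *
        p ^ (#{g | β g = true ∧ j < g} + b.toNat - 1) * T a b * barredWeight p q T τ β := by
  unfold barredWeight
  rw [Fin.prod_univ_succAbove _ j, ← leftCross_insertMin_self j a b τ β h0,
    ← rightCross_insertMin_self j a b τ β h1]
  simp [leftCross_insertMin, rightCross_insertMin, hβ, leftBelow_insertMin, rightBelow_insertMin,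
    leftBelow_insertMin_self, rightBelow_insertMin_self]

/-- The total weight of the ways to insert a smallest letter at one of `N'` bars. -/
theorem sum_range_insert_eq (p q : R) {N N' : ℕ} (a b : Bool) (hN' : 1 ≤ N')
    (h : N + 1 = N' + a.toNat + b.toNat) :
    (∑ x ∈ range N', if 1 ≤ x + a.toNat ∧ 1 ≤ N' - 1 - x + b.toNat then
      q ^ (x + a.toNat - 1) * p ^ (N' - 1 - x + b.toNat - 1) else 0) = pqNat p q (N - 1) := by
  obtain ⟨N', rfl⟩ := Nat.exists_eq_add_of_le' hN'
  unfold pqNat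
  have hlast : ∀ {f : ℕ → R}, (∀ x, x < N' → f x = q ^ x * p ^ (N' - 1 - x)) → f N' = 0 →
      ∑ x ∈ range (N' + 1), f x = ∑ x ∈ range N', q ^ x * p ^ (N' - 1 - x) := by
    intro f hf h0
    rw [sum_range_succ, h0, add_zero]
    exact sum_congr rfl fun x hx => hf x (mem_range.1 hx)
  -- Here x counts the bars left of the insertion. Without a left bar (`a = false`) x = 0 is
  -- excluded, without a right bar the last x is; the rest reindexes to [N-1].
  cases a <;> cases b <;> simp only [Bool.toNat_true, Bool.toNat_false] at h ⊢
  · obtain rfl : N = N' := by omega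
    obtain _ | N := N
    · simp
    · rw [sum_range_succ']
      simp only [add_zero, nonpos_iff_eq_zero, one_ne_zero, false_and, if_false]
      rw [sum_range_succ, if_neg (by omega), add_zero]
      refine sum_congr rfl fun x hx => ?_
      rw [mem_range] at hx
      rw [if_pos (by omega), show x + 1 - 1 = x by omega]
      congr 2; omega
  · obtain rfl : N = N' + 1 := by omega
    rw [sum_range_succ']
    simp only [add_zero, nonpos_iff_eq_zero, one_ne_zero, false_and, if_false]
    refine sum_congr rfl fun x hx => ?_
    rw [mem_range] at hx
    rw [if_pos (by omega), show x + 1 - 1 = x by omega]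
    congr 2; omega
  · obtain rfl : N = N' + 1 := by omega
    refine hlast (fun x hx => ?_) (if_neg (by omega))
    rw [if_pos (by omega), show x + 1 - 1 = x by omega]
    congr 2; omega
  · obtain rfl : N = N' + 2 := by omega
    refine sum_congr (by congr 1) fun x hx => ?_
    rw [mem_range] at hx
    rw [if_pos (by omega), show x + 1 - 1 = x by omega]
    congr 2

/-- For fixed `β`, `a`, `b`, both admissibility and weight of an insertion depend on `j` only
through the numbers of bars on its two sides. -/
theorem sum_insertMin_eq (p q : R) (T : Bool → Bool → R) (N : ℕ) (τ : Equiv.Perm (Fin m))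
    (β : Fin (m + 1) → Bool) (a b : Bool) :
    (∑ j with β j = true, if splitGap j a b β ∈ bars (m + 1) N then
      barredWeight p q T (insertMin j τ) (splitGap j a b β) else 0) =
    if β 0 = true ∧ β (Fin.last m) = true ∧ N + 1 = #{g | β g = true} + a.toNat + b.toNat then
      pqNat p q (N - 1) * T a b * barredWeight p q T τ β else 0 := by
  split_ifs with h
  · obtain ⟨h0, h1, hN⟩ := h
    have hpos : 1 ≤ #{g | β g = true} := card_pos.2 ⟨0, by simp [h0]⟩
    rw [← sum_range_insert_eq p q a b hpos hN, sum_mul, sum_mul,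
      ← sum_card_lt_card_gt {g | β g = true} fun x y =>
        (if 1 ≤ x + a.toNat ∧ 1 ≤ y + b.toNat then
          q ^ (x + a.toNat - 1) * p ^ (y + b.toNat - 1) else 0) * T a b * barredWeight p q T τ β]
    refine sum_congr rfl fun j hj => ?_
    simp only [mem_filter, mem_univ, true_and] at hj
    simp only [filter_filter]
    have hc := card_splitGap j a b β hj
    have hiff : splitGap j a b β ∈ bars (m + 1) N ↔
        1 ≤ #{g | β g = true ∧ g < j} + a.toNat ∧ 1 ≤ #{g | β g = true ∧ j < g} + b.toNat := by
      simp only [bars, mem_filter, mem_univ, true_and]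
      rw [splitGap_zero_iff j a b β hj, splitGap_last_iff j a b β hj]
      simp only [h0, h1, true_and]
      have : #{g | splitGap j a b β g = true} = N := by omega
      tauto
    by_cases hs : splitGap j a b β ∈ bars (m + 1) N
    · rw [if_pos hs, if_pos (hiff.1 hs)]
      simp only [bars, mem_filter, mem_univ, true_and] at hs
      exact barredWeight_insertMin p q T j a b τ β hj hs.1 hs.2.1
    · rw [if_neg hs, if_neg fun h => hs (hiff.2 h)]
      simp
  · refine sum_eq_zero fun j hj => if_neg fun hs => h ?_
    simp only [mem_filter, mem_univ, true_and] at hj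
    simp only [bars, mem_filter, mem_univ, true_and] at hs
    rw [splitGap_zero_iff j a b β hj, splitGap_last_iff j a b β hj] at hs
    have hc := card_splitGap j a b β hj
    have hN : #{g | splitGap j a b β g = true} = N := hs.2.2
    exact ⟨hs.1.1, hs.2.1.1, by omega⟩

theorem sum_ite_bars_eq (p q : R) (T : Bool → Bool → R) (m N : ℕ) (a b : Bool) :
    (∑ τ : Equiv.Perm (Fin m), ∑ β : Fin (m + 1) → Bool,
      if β 0 = true ∧ β (Fin.last m) = true ∧ N + 1 = #{g | β g = true} + a.toNat + b.toNat then
        pqNat p q (N - 1) * T a b * barredWeight p q T τ β else 0) =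
      pqNat p q (N - 1) * (T a b * barredSum p q T m (N + 1 - a.toNat - b.toNat)) := by
  -- For N = 0 the subtraction on the right may truncate, but the factor [0] vanishes.
  obtain _ | N := N
  · simp [pqNat_zero]
  · simp only [barredSum, bars, ← mul_assoc, mul_sum, sum_filter]
    refine sum_congr rfl fun τ _ => sum_congr rfl fun β _ => ?_
    rw [mul_ite, mul_zero]
    refine if_congr (and_congr_right fun _ => and_congr_right fun _ => ?_) rfl rfl
    have := Bool.toNat_le a
    have := Bool.toNat_le b
    omega

/-- Removing the smallest letter, and merging the two gaps around it into one with a bar. -/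
theorem barredSum_succ (p q : R) (T : Bool → Bool → R) (m N : ℕ) :
    barredSum p q T (m + 1) N = pqNat p q (N - 1) * (T false false * barredSum p q T m (N + 1) +
      (T true false + T false true) * barredSum p q T m N +
      T true true * barredSum p q T m (N - 1)) := by
  have h : barredSum p q T (m + 1) N = ∑ a, ∑ b,
      pqNat p q (N - 1) * (T a b * barredSum p q T m (N + 1 - a.toNat - b.toNat)) := by
    simp_rw [← sum_ite_bars_eq, ← sum_insertMin_eq]
    have h' : ∀ σ : Equiv.Perm (Fin (m + 1)), ∑ β ∈ bars (m + 1) N, barredWeight p q T σ β =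
        ∑ β, if β ∈ bars (m + 1) N then barredWeight p q T σ β else 0 := by simp
    simp_rw [barredSum, h']
    rw [sum_perm_succ, sum_congr rfl fun j _ => sum_congr rfl fun τ _ => sum_bars_succ j _]
    simp_rw [sum_filter]
    have h'' : ∀ (j : Fin (m + 1)) (β : Fin (m + 1) → Bool) (f : Bool → Bool → R),
        (if β j = true then ∑ a, ∑ b, f a b else 0) =
          ∑ a, ∑ b, if β j = true then f a b else 0 := by
      intro j β f; split_ifs <;> simp
    simp_rw [h'', ← Fintype.sum_prod_type']
    -- Only the order of the five summations differs.
    exact Fintype.sum_equiv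
      { toFun := fun x => (x.2.2.2.1, x.2.2.2.2, x.2.1, x.2.2.1, x.1)
        invFun := fun x => (x.2.2.2.2, x.2.2.1, x.2.2.2.1, x.1, x.2.1)
        left_inv := fun _ => rfl
        right_inv := fun _ => rfl } _ _ fun _ => rfl
  rw [h]
  simp only [Fintype.sum_bool, Bool.toNat_true, Bool.toNat_false, tsub_zero,
    Nat.add_sub_cancel, Nat.sub_sub, Nat.add_sub_add_right, add_zero]
  ring

theorem barredSum_eq_motzkinSum (p q : R) (T : Bool → Bool → R) (m N : ℕ) :
    barredSum p q T m N =
      motzkinSum p q (T false false) (T true false + T false true) (T true true) m N := by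
  induction m generalizing N with
  | zero =>
    -- Without letters the single gap is both ends, so exactly one bar is present: paths stop at
    -- height 1.
    have h : ∀ β : Fin 1 → Bool, β ∈ bars 0 N ↔ β = (fun _ => true) ∧ N = 1 := by
      intro β
      simp only [bars, mem_filter, mem_univ, true_and]
      constructor
      · rintro ⟨h0, -, h⟩
        have : β = fun _ => true := by
          ext g; rw [Subsingleton.elim g 0, h0]
        subst this
        simpa [eq_comm] using h
      · rintro ⟨rfl, rfl⟩
        simp
    simp only [barredSum, barredWeight, motzkinSum, univ_eq_empty, prod_empty]
    split_ifs with hN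
    · have : bars 0 N = {fun _ => true} := by ext β; rw [h, mem_singleton]; simp [hN]
      simp [this]
    · have : bars 0 N = ∅ := by ext β; rw [h]; simp [hN]
      simp [this]
  | succ m ih => rw [barredSum_succ, motzkinSum, ih, ih, ih]

end Barred

/-! ### The statistics in terms of barred permutations -/

section Statistics

variable {n : ℕ}

theorem word_succ (b : ℕ) (σ : Equiv.Perm (Fin n)) (i : Fin n) :
    word b σ (i + 1) = σ i + 1 := by
  have := i.isLt
  simp [word]

theorem word_eq (b : ℕ) (σ : Equiv.Perm (Fin n)) {i : ℕ} (h1 : 1 ≤ i) (h2 : i ≤ n) :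
    word b σ i = σ ⟨i - 1, by omega⟩ + 1 := by
  simp [word, h1, h2]

theorem word_outside (b : ℕ) (σ : Equiv.Perm (Fin n)) {i : ℕ} (h : i = 0 ∨ n < i) :
    word b σ i = b := by
  unfold word
  rw [dif_neg]
  omega

theorem word_ne_word_succ (hn : 1 ≤ n) (σ : Equiv.Perm (Fin n)) {i : ℕ} (hi : i ≤ n) :
    word 0 σ i ≠ word 0 σ (i + 1) := by
  obtain rfl | h0 := Nat.eq_zero_or_pos i
  · rw [word_outside 0 σ (Or.inl rfl), word_eq 0 σ le_rfl hn]
    omega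
  obtain rfl | h1 := hi.eq_or_lt
  · rw [word_outside 0 σ (i := i + 1) (by omega), word_eq 0 σ hn le_rfl]
    omega
  · rw [word_eq 0 σ h0 hi, word_eq 0 σ (by omega) h1]
    intro h
    have := σ.injective (Fin.ext (Nat.succ_injective h))
    simp [Fin.ext_iff] at this
    omega

theorem card_filter_Icc_one (P : ℕ → Prop) [DecidablePred P] :
    #{i ∈ Icc 1 n | P i} = #{i : Fin n | P (i + 1)} := by
  symm
  refine card_bij (fun i _ => (i : ℕ) + 1) ?_ ?_ ?_
  · intro i hi
    have := i.isLt
    simpa [Nat.succ_le_iff] using hi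
  · intro i _ j _ h
    exact Fin.ext (by simpa using h)
  · intro i hi
    simp at hi
    refine ⟨⟨i - 1, by omega⟩, ?_, by simp; omega⟩
    simp [Nat.sub_add_cancel hi.1.1, hi.2]

/-- Index a descent by its lower entry, which is a double descent or a valley according to the next
comparison; position 1 never occurs since σ(0) = 0. -/
theorem des_eq (hn : 1 ≤ n) (σ : Equiv.Perm (Fin n)) :
    des σ = doubleDescent 0 σ + valley 0 σ := by
  have h1 : des σ = #{i ∈ Icc 1 n | word 0 σ (i - 1) > word 0 σ i} := by
    refine card_bij (fun i _ => i + 1) ?_ ?_ ?_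
    · intro i hi
      simp at hi ⊢
      exact ⟨by omega, hi.2.2⟩
    · intro i _ j _ h
      simpa using h
    · intro i hi
      simp at hi
      have : i ≠ 1 := by
        rintro rfl
        rw [word_outside 0 σ (Or.inl rfl)] at hi
        omega
      refine ⟨i - 1, ?_, by omega⟩
      simp [Nat.sub_add_cancel hi.1.1, hi.2]
      omega
  rw [h1, doubleDescent, valley,
    ← card_filter_add_card_filter_not (fun i => word 0 σ i > word 0 σ (i + 1)), filter_filter,
    filter_filter]
  congr 2
  refine filter_congr fun i hi => ?_
  have := word_ne_word_succ hn σ (mem_Icc.1 hi).2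
  refine and_congr_right fun _ => ?_
  omega

/-- Bars at the two ends only. -/
def endBars (n : ℕ) : Fin (n + 1) → Bool := fun g => decide (g = 0 ∨ g = Fin.last n)

theorem bars_two (hn : 1 ≤ n) : bars n 2 = {endBars n} := by
  have h0 : (0 : Fin (n + 1)) ≠ Fin.last n := by
    simp [Fin.ext_iff]; omega
  have hcard : #({0, Fin.last n} : Finset (Fin (n + 1))) = 2 := card_pair h0
  ext β
  simp only [bars, mem_filter, mem_univ, true_and, mem_singleton]
  constructor
  · rintro ⟨hz, hl, hc⟩
    have hsub : ({0, Fin.last n} : Finset (Fin (n + 1))) ⊆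
        univ.filter fun g => β g = true := by
      intro g hg
      simp only [mem_insert, mem_singleton] at hg
      obtain rfl | rfl := hg <;> simp [hz, hl]
    have heq := eq_of_subset_of_card_le hsub (by rw [hc, hcard])
    ext g
    have := congrArg (g ∈ ·) heq
    simp only [mem_insert, mem_singleton, mem_filter, mem_univ, true_and, eq_iff_iff] at this
    rw [Bool.eq_iff_iff, ← this]
    simp [endBars]
  · rintro rfl
    refine ⟨by simp [endBars], by simp [endBars], ?_⟩
    rw [← hcard]
    congr 1
    ext g
    simp [endBars]

theorem leftBelow_endBars (σ : Equiv.Perm (Fin n)) (c k : Fin n) :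
    LeftBelow σ (endBars n) c k ↔ word 0 σ k < c + 1 := by
  unfold LeftBelow endBars
  have hk := k.isLt
  obtain h0 | h0 := Nat.eq_zero_or_pos (k : ℕ)
  · rw [word_outside 0 σ (Or.inl h0)]
    simp [Fin.ext_iff, h0]
  · rw [word_eq 0 σ h0 hk.le]
    have h1 : ¬ (k.castSucc = 0 ∨ k.castSucc = Fin.last n) := by
      simp only [Fin.ext_iff, Fin.val_castSucc, Fin.val_zero, Fin.val_last]; omega
    simp only [h1, decide_false, Bool.false_eq_true, false_or]
    constructor
    · rintro ⟨l, hl, hc⟩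
      have : l = ⟨k - 1, by omega⟩ := Fin.ext (by simp; omega)
      rw [this, Fin.lt_def] at hc
      omega
    · intro h
      exact ⟨⟨k - 1, by omega⟩, by simp; omega, Fin.lt_def.2 (by omega)⟩

theorem rightBelow_endBars (σ : Equiv.Perm (Fin n)) (c k : Fin n) :
    RightBelow σ (endBars n) c k ↔ word 0 σ (k + 2) < c + 1 := by
  unfold RightBelow endBars
  have hk := k.isLt
  obtain h0 | h0 := Nat.lt_or_ge n (k + 2)
  · rw [word_outside 0 σ (Or.inr h0)]
    have : (k : ℕ) + 1 = n := by omega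
    simp [Fin.ext_iff, this]
  · rw [word_eq 0 σ (by omega) h0]
    have h1 : ¬ (k.succ = 0 ∨ k.succ = Fin.last n) := by
      simp only [Fin.ext_iff, Fin.val_succ, Fin.val_zero, Fin.val_last]; omega
    simp only [h1, decide_false, Bool.false_eq_true, false_or]
    constructor
    · rintro ⟨l, hl, hc⟩
      have : l = ⟨k + 2 - 1, by omega⟩ := Fin.ext (by simp; omega)
      rw [this, Fin.lt_def] at hc
      omega
    · intro h
      exact ⟨⟨k + 2 - 1, by omega⟩, by simp, Fin.lt_def.2 (by omega)⟩

theorem sum_card_filter_eq {α β : Type*} [Fintype α] [Fintype β] (P : α → β → Prop)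
    [∀ a, DecidablePred (P a)] :
    ∑ a, #{b | P a b} = #{x : α × β | P x.1 x.2} := by
  simp_rw [card_filter]
  rw [Fintype.sum_prod_type]

theorem les_eq (σ : Equiv.Perm (Fin n)) : les σ = ∑ i, leftCross σ (endBars n) i := by
  unfold leftCross
  rw [sum_card_filter_eq fun i k => k < i ∧ σ i < σ k ∧ RightBelow σ (endBars n) (σ i) k]
  symm
  -- In 1-based positions, k + 2 is the lower entry of the descent starting at k, and i + 1 the
  -- letter crossed.
  refine card_bij (fun x _ => ((x.2 : ℕ) + 2, (x.1 : ℕ) + 1)) ?_ ?_ ?_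
  · rintro ⟨i, k⟩ hx
    simp only [mem_filter, mem_univ, true_and, rightBelow_endBars, Fin.lt_def] at hx
    have := i.isLt
    have hk := word_succ 0 σ k
    have hi := word_succ 0 σ i
    simp only [mem_filter, mem_product, mem_Icc]
    rw [show (k : ℕ) + 2 - 1 = k + 1 by omega]
    have hne : (k : ℕ) + 1 ≠ i := by
      intro h
      rw [show (k : ℕ) + 2 = i + 1 by omega] at hx
      omega
    omega
  · rintro ⟨i, k⟩ _ ⟨i', k'⟩ _ h
    simp only [Prod.mk.injEq] at h
    ext <;> simp <;> omega
  · rintro ⟨a, b⟩ hx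
    simp only [mem_filter, mem_product, mem_Icc] at hx
    refine ⟨(⟨b - 1, by omega⟩, ⟨a - 2, by omega⟩), ?_, by ext <;> simp <;> omega⟩
    have h1 := word_eq 0 σ (i := b) (by omega) (by omega)
    have h2 := word_eq 0 σ (i := a - 1) (by omega) (by omega)
    simp only [mem_filter, mem_univ, true_and, rightBelow_endBars, Fin.lt_def]
    simp only [show a - 1 - 1 = a - 2 by omega] at h2
    rw [show a - 2 + 2 = a by omega]
    omega

theorem res_eq (σ : Equiv.Perm (Fin n)) : res σ = ∑ i, rightCross σ (endBars n) i := by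
  unfold rightCross
  rw [sum_card_filter_eq fun i k => i < k ∧ σ i < σ k ∧ LeftBelow σ (endBars n) (σ i) k]
  symm
  refine card_bij (fun x _ => ((x.1 : ℕ) + 1, (x.2 : ℕ))) ?_ ?_ ?_
  · rintro ⟨i, k⟩ hx
    simp only [mem_filter, mem_univ, true_and, leftBelow_endBars, Fin.lt_def] at hx
    have := k.isLt
    have hk := word_succ 0 σ k
    have hi := word_succ 0 σ i
    simp only [mem_filter, mem_product, mem_Icc]
    have hne : (i : ℕ) + 1 ≠ k := by
      intro h
      rw [← h] at hx
      omega
    omega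
  · rintro ⟨i, k⟩ _ ⟨i', k'⟩ _ h
    simp only [Prod.mk.injEq] at h
    ext <;> simp <;> omega
  · rintro ⟨a, b⟩ hx
    simp only [mem_filter, mem_product, mem_Icc] at hx
    refine ⟨(⟨a - 1, by omega⟩, ⟨b, by omega⟩), ?_, by ext <;> simp; omega⟩
    have h1 := word_eq 0 σ (i := a) (by omega) (by omega)
    have h2 := word_eq 0 σ (i := b + 1) (by omega) (by omega)
    simp only [mem_filter, mem_univ, true_and, leftBelow_endBars, Fin.lt_def]
    simp only [Nat.add_sub_cancel] at h2
    omega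

/-! ### Generating functions of permutations -/

variable {R : Type*} [CommRing R]

/-- The weight `x`, `y`, `z` or `1` of a valley, double ascent, double descent or peak. -/
def letterWeight (x y z : R) : Bool → Bool → R
  | false, false => x
  | true, false => y
  | false, true => z
  | true, true => 1

theorem letterWeight_eq (x y z : R) (P Q : Prop) [Decidable P] [Decidable Q] :
    letterWeight x y z (decide P) (decide Q) =
      (if ¬ P ∧ ¬ Q then x else 1) * (if P ∧ ¬ Q then y else 1) * (if ¬ P ∧ Q then z else 1) := by
  by_cases P <;> by_cases Q <;> simp [letterWeight, *]

theorem barredWeight_endBars (hn : 1 ≤ n) (p q x y z : R) (σ : Equiv.Perm (Fin n)) :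
    barredWeight p q (letterWeight x y z) σ (endBars n) =
      p ^ res σ * q ^ les σ * x ^ valley 0 σ * y ^ doubleAscent 0 σ * z ^ doubleDescent 0 σ := by
  unfold barredWeight
  simp_rw [letterWeight_eq]
  simp only [prod_mul_distrib, prod_pow_eq_pow_sum, ← les_eq, ← res_eq, prod_ite, prod_const_one,
    prod_const, mul_one, valley, doubleAscent, doubleDescent, card_filter_Icc_one]
  have hne : ∀ i : Fin n, word 0 σ i ≠ word 0 σ (i + 1) ∧
      word 0 σ (i + 1) ≠ word 0 σ (i + 1 + 1) := fun i =>
    ⟨word_ne_word_succ hn σ i.isLt.le, word_ne_word_succ hn σ i.isLt⟩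
  simp only [leftBelow_endBars, rightBelow_endBars, ← word_succ 0 σ]
  rw [mul_comm (q ^ _)]
  simp only [mul_assoc]
  congr 6
  · funext i
    have := hne i
    rw [Nat.add_sub_cancel, add_assoc, one_add_one_eq_two] at *
    rw [eq_iff_iff]
    omega
  all_goals
    refine filter_congr fun i _ => ?_
    have := hne i
    rw [Nat.add_sub_cancel, add_assoc, one_add_one_eq_two] at *
    omega

/-- The main generating function identity. -/
theorem sum_perm_eq_motzkinSum (hn : 1 ≤ n) (p q x y z : R) :
    ∑ σ : Equiv.Perm (Fin n),
      p ^ res σ * q ^ les σ * x ^ valley 0 σ * y ^ doubleAscent 0 σ * z ^ doubleDescent 0 σ =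
    motzkinSum p q x (y + z) 1 n 2 := by
  have := barredSum_eq_motzkinSum p q (letterWeight x y z) n 2
  simp only [barredSum, bars_two hn, sum_singleton, barredWeight_endBars hn] at this
  exact this

theorem sum_perm_eq (hn : 1 ≤ n) (p q x y z : R) :
    ∑ σ : Equiv.Perm (Fin n),
      p ^ res σ * q ^ les σ * x ^ valley 0 σ * y ^ doubleAscent 0 σ * z ^ doubleDescent 0 σ =
    ∑ k ∈ range ((n - 1) / 2 + 1),
      motzkinCoeff p q n 2 k * x ^ k * (y + z) ^ (n - 1 - 2 * k) := by
  rw [sum_perm_eq_motzkinSum hn, motzkinSum_eq_sum (K := (n - 1) / 2) _ _ _ _ (by omega) (by omega)]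
  rfl

/-- The refinement of `sum_perm_eq` by the number of valleys. -/
theorem sum_perm_valley_eq (hn : 1 ≤ n) (p q y z : R) {k : ℕ} (hk : k ≤ (n - 1) / 2) :
    ∑ σ : Equiv.Perm (Fin n) with valley 0 σ = k,
      p ^ res σ * q ^ les σ * y ^ doubleAscent 0 σ * z ^ doubleDescent 0 σ =
    motzkinCoeff p q n 2 k * (y + z) ^ (n - 1 - 2 * k) := by
  -- Marking valleys by a polynomial variable over `R` allows comparison of coefficients.
  have h := congrArg (fun f => Polynomial.coeff f k)
    (sum_perm_eq hn (Polynomial.C p) (Polynomial.C q) Polynomial.X (Polynomial.C y)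
      (Polynomial.C z))
  simp only [Polynomial.finsetSum_coeff] at h
  have h1 : ∀ σ : Equiv.Perm (Fin n), (Polynomial.C p ^ res σ * Polynomial.C q ^ les σ *
      Polynomial.X ^ valley 0 σ * Polynomial.C y ^ doubleAscent 0 σ *
      Polynomial.C z ^ doubleDescent 0 σ).coeff k = if valley 0 σ = k then
        p ^ res σ * q ^ les σ * y ^ doubleAscent 0 σ * z ^ doubleDescent 0 σ else 0 := by
    intro σ
    rw [show Polynomial.C p ^ res σ * Polynomial.C q ^ les σ *
      Polynomial.X ^ valley 0 σ * Polynomial.C y ^ doubleAscent 0 σ *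
      Polynomial.C z ^ doubleDescent 0 σ = Polynomial.C (p ^ res σ * q ^ les σ *
        y ^ doubleAscent 0 σ * z ^ doubleDescent 0 σ) * Polynomial.X ^ valley 0 σ by
          simp only [map_mul, map_pow]; ring]
    rw [Polynomial.coeff_C_mul_X_pow]
    exact if_congr eq_comm rfl rfl
  have h2 : ∀ r : ℕ, (motzkinCoeff (Polynomial.C p) (Polynomial.C q) n 2 r * Polynomial.X ^ r *
      (Polynomial.C y + Polynomial.C z) ^ (n - 1 - 2 * r)).coeff k = if r = k then
        motzkinCoeff p q n 2 r * (y + z) ^ (n - 1 - 2 * r) else 0 := by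
    intro r
    rw [← map_motzkinCoeff, ← map_add, ← map_pow, mul_right_comm, ← map_mul,
      Polynomial.coeff_C_mul_X_pow]
    exact if_congr eq_comm rfl rfl
  simp only [h1, h2] at h
  rw [sum_filter, h, sum_ite_eq', if_pos (by rw [mem_range]; omega)]

/-- At y = 1, z = 0 the power of z is the indicator of having no double descent, and y + z = 1. -/
theorem gammaCoeff_eq (hn : 1 ≤ n) {k : ℕ} (hk : k ≤ (n - 1) / 2) :
    gammaCoeff n k = motzkinCoeff (MvPolynomial.X 0) (MvPolynomial.X 1) n 2 k := by
  have h := sum_perm_valley_eq hn (MvPolynomial.X 0 : MvPolynomial (Fin 2) ℤ)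
    (MvPolynomial.X 1) 1 0 hk
  rw [add_zero, one_pow, mul_one] at h
  rw [← h, gammaCoeff, permsValley, ← filter_filter,
    sum_filter (fun σ => doubleDescent 0 σ = 0)]
  refine sum_congr rfl fun σ _ => ?_
  rw [one_pow, mul_one, zero_pow_eq, mul_ite, mul_one, mul_zero]

/-- Since des = dd + valley, the powers of t are absorbed by x = tw, y = u, z = vt. -/
theorem genEulerian_eq (hn : 1 ≤ n) :
    genEulerian n = ∑ k ∈ range ((n - 1) / 2 + 1), inclPQ (gammaCoeff n k) *
      (MvPolynomial.X 2 * MvPolynomial.X 5) ^ k *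
      (MvPolynomial.X 3 + MvPolynomial.X 4 * MvPolynomial.X 2) ^ (n - 1 - 2 * k) := by
  have h := sum_perm_eq hn (MvPolynomial.X 0 : MvPolynomial (Fin 6) ℤ) (MvPolynomial.X 1)
    (MvPolynomial.X 2 * MvPolynomial.X 5) (MvPolynomial.X 3) (MvPolynomial.X 4 * MvPolynomial.X 2)
  have hl : genEulerian n = _ := (sum_congr rfl fun σ _ => ?_).trans h
  · rw [hl]
    refine sum_congr rfl fun k hk => ?_
    rw [gammaCoeff_eq hn (by rw [mem_range] at hk; omega)]
    have := map_motzkinCoeff inclPQ.toRingHom (MvPolynomial.X 0) (MvPolynomial.X 1) n 2 k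
    simp only [AlgHom.toRingHom_eq_coe, RingHom.coe_coe] at this
    rw [this]
    simp [inclPQ]
  · rw [des_eq hn]
    ring

/-! ### Complementation -/

/-- The complement `i ↦ n + 1 - σ(i)` of a permutation. -/
def complement (σ : Equiv.Perm (Fin n)) : Equiv.Perm (Fin n) := σ.trans Fin.revPerm

theorem complement_complement (σ : Equiv.Perm (Fin n)) : complement (complement σ) = σ := by
  ext i; simp [complement]

/-- The boundary values 0 and n + 1 are complementary too, so no position is exceptional. -/
theorem word_complement (σ : Equiv.Perm (Fin n)) (i : ℕ) :
    word 0 (complement σ) i + word (n + 1) σ i = n + 1 := by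
  unfold word
  split_ifs with h
  · have := (σ ⟨i - 1, by omega⟩).isLt
    simp [complement, Fin.val_rev]
    omega
  · simp

theorem word_complement_inside (σ : Equiv.Perm (Fin n)) {i : ℕ} (h1 : 1 ≤ i) (h2 : i ≤ n) :
    word 0 (complement σ) i + word 0 σ i = n + 1 := by
  rw [word_eq 0 σ h1 h2, ← word_eq (n + 1) σ h1 h2, word_complement]

theorem valley_complement (σ : Equiv.Perm (Fin n)) : valley 0 (complement σ) = peak (n + 1) σ := by
  unfold valley peak
  congr 1
  refine filter_congr fun i _ => ?_
  have h1 := word_complement σ (i - 1)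
  have h2 := word_complement σ i
  have h3 := word_complement σ (i + 1)
  omega

theorem les_complement (σ : Equiv.Perm (Fin n)) : les (complement σ) = pat13_2 σ := by
  unfold les pat13_2
  congr 1
  refine filter_congr fun x hx => ?_
  refine and_congr_right fun h1 => and_congr_right fun h2 => and_congr_right fun h3 => ?_
  have h1 := word_complement_inside σ (i := x.1 - 1) (by omega) (by omega)
  have h2 := word_complement_inside σ (i := x.1) (by omega) (by omega)
  have h3 := word_complement_inside σ (i := x.2) (by omega) (by omega)
  omega

theorem res_complement (σ : Equiv.Perm (Fin n)) : res (complement σ) = pat2_31 σ := by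
  unfold res pat2_31
  congr 1
  refine filter_congr fun x hx => ?_
  refine and_congr_right fun h1 => and_congr_right fun h2 => and_congr_right fun h3 => ?_
  have h1 := word_complement_inside σ (i := x.1) (by omega) (by omega)
  have h2 := word_complement_inside σ (i := x.2) (by omega) (by omega)
  have h3 := word_complement_inside σ (i := x.2 + 1) (by omega) (by omega)
  omega

theorem peakSum_eq (n k : ℕ) :
    peakSum n k = ∑ σ : Equiv.Perm (Fin n) with valley 0 σ = k,
      MvPolynomial.X 0 ^ les σ * MvPolynomial.X 1 ^ res σ := by
  refine sum_nbij' complement complement ?_ ?_ ?_ ?_ ?_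
  · intro σ hσ
    simpa [valley_complement] using hσ
  · intro σ hσ
    simpa [← valley_complement, complement_complement] using hσ
  · exact fun σ _ => complement_complement σ
  · exact fun σ _ => complement_complement σ
  · intro σ _
    rw [les_complement, res_complement]

/-- Here y = z = 1, so y + z = 2. Complementation attaches p to `les` and q to `res`, the reverse of
a_{n,k}; the symmetry of the path coefficients undoes this. -/
theorem two_pow_mul_gammaCoeff (hn : 1 ≤ n) {k : ℕ} (hk : k ≤ (n - 1) / 2) :
    2 ^ (n - 1 - 2 * k) * gammaCoeff n k = peakSum n k := by
  have h := sum_perm_valley_eq hn (MvPolynomial.X 1 : MvPolynomial (Fin 2) ℤ)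
    (MvPolynomial.X 0) 1 1 hk
  rw [one_add_one_eq_two] at h
  rw [gammaCoeff_eq hn hk, motzkinCoeff_comm, mul_comm, ← h, peakSum_eq]
  refine sum_congr rfl fun σ _ => ?_
  rw [one_pow, one_pow, mul_one, mul_one, mul_comm]

end Statistics

end PermStat

theorem mainTheorem1 (n : ℕ) (hn : 1 ≤ n) :
    -- the expansion in `ℤ[p,q,t,u,v,w]`, with `p, q, t, u, v, w = X 0, …, X 5`
    (PermStat.genEulerian n =
      ∑ k ∈ Finset.range ((n - 1) / 2 + 1),
        PermStat.inclPQ (PermStat.gammaCoeff n k) *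
          (MvPolynomial.X 2 * MvPolynomial.X 5) ^ k *
          (MvPolynomial.X 3 + MvPolynomial.X 4 * MvPolynomial.X 2) ^ (n - 1 - 2 * k)) ∧
    -- the divisibility in `ℤ[p,q]`
    (∀ k : ℕ, k ≤ (n - 1) / 2 →
      ((MvPolynomial.X 0 + MvPolynomial.X 1) ^ k : MvPolynomial (Fin 2) ℤ) ∣
        PermStat.gammaCoeff n k) ∧
    -- the polynomials in Brändén's conjecture are the `a_{n,k}(p,q)`
    (∀ k : ℕ, k ≤ (n - 1) / 2 →
      (2 : MvPolynomial (Fin 2) ℤ) ^ (n - 1 - 2 * k) * PermStat.gammaCoeff n k =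
        PermStat.peakSum n k) := by
  refine ⟨PermStat.genEulerian_eq hn, fun k hk => ?_, fun k hk =>
    PermStat.two_pow_mul_gammaCoeff hn hk⟩
  rw [PermStat.gammaCoeff_eq hn hk]
  -- At starting height 2 the extra exponent (2 - 1) / 2 is zero.
  exact PermStat.add_pow_dvd_motzkinCoeff _ _ n 2 k
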